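/- A \emph{Garside structure} $(G,P,\Delta)$ on a group $G$ consists of a submonoid $P\subseteq G$ with $P\cap P^{-1}=\{1\}$ and an element $\Delta\in P$ such that: (G1) the partial order $a\preccurlyeq b\Leftrightarrow a^{-1}b\in P$ on $G$ is a lattice order, with greatest common divisor $a\wedge b$ and least common multiple $a\vee b$; (G2) the set $[1,\Delta]=\{s\in G: 1\preccurlyeq s\preccurlyeq\Delta\}$ of \emph{simple elements} generates $G$; (G3) $\Delta^{-1}P\Delta=P$; (G4) for each $x\in P\setminus\{1\}$ the number of factors in decompositions of $x$ as a product of elements of $P\setminus\{1\}$ is bounded. It is \emph{of finite type} if $[1,\Delta]$ is finite. An \emph{atom} is an element $a\in P\setminus\{1\}$ such that $a=bc$ with $b,c\in P$ implies $b=1$ or $c=1$. For a simple element $s$ put $\partial(s)=s^{-1}\Delta$. Every $x\in G$ has a left normal form $x=\Delta^p x_1\cdots x_r$ with $p\in\mathbb Z$, $r\ge 0$, $x_i\in[1,\Delta]\setminus\{1,\Delta\}$ and $\partial(x_i)\wedge x_{i+1}=1$ for $1\le i<r$; it is unique if $G$ is nontrivial. Put $\inf(x)=p$ (if $G$ is trivial,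 the choice of $p$ is immaterial). Let $\iota(x)=x\Delta^{-\inf(x)}\wedge\Delta$, let $\mathfrak p(x)=\iota(x)\wedge\iota(x^{-1})$ be the \emph{preferred prefix} of $x$, and let $\mathfrak s(x)=\mathfrak p(x)^{-1}\,x\,\mathfrak p(x)$ be the \emph{cyclic sliding} of $x$. The \emph{set of sliding circuits} ${\rm SC}(x)$ is the set of all conjugates $y$ of $x$ such that $\mathfrak s^m(y)=y$ for some $m\ge 1$. Write $y^s=s^{-1}ys$. For $y\in{\rm SC}(x)$, an \emph{indecomposable conjugator starting at $y$} is an element $s\in P\setminus\{1\}$ such that $y^s\in{\rm SC}(x)$ and such that there is no decomposition $s=s_1s_2$ with $s_1,s_2\in P\setminus\{1\}$ and $y^{s_1}\in{\rm SC}(x)$. The \emph{sliding circuits graph} ${\rm SCG}(x)$ is the directed graph whose vertices are the elements of ${\rm SC}(x)$ and which has, for every $y\in{\rm SC}(x)$ and every indecomposable conjugator $s$ starting at $y$, one arrow labelled $s$ from $y$ to $y^s$. \textbf{Corollary.} Let $G$ be a group with a Garside structure $(G,P,\Delta)$ of finite type, and let $x\in G$. Then ${\rm SCG}(x)$ is finite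 (it has finitely many vertices and finitely many arrows), and it is connected: it is non-empty, and for any two vertices $y,z$ there is a directed path from $y$ to $z$. Moreover, the label of every arrow of ${\rm SCG}(x)$ is a simple element, and the number of arrows starting at any given vertex is at most the number of atoms of $(G,P,\Delta)$. -/

import Mathlib

/-- A Garside structure `(G, P, Δ)` on a group `G`. The divisibility order `a ≼ b` is written out
here as `a⁻¹ * b ∈ P`. -/
structure GarsideStructure (G : Type*) [Group G] where
  /-- The monoid of positive elements. -/
  P : Submonoid G
  /-- The Garside element. -/
  Δ : G
  Δ_mem : Δ ∈ P
  /-- `P ∩ P⁻¹ = {1}`. -/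
  eq_one_of_mem_of_inv_mem : ∀ a : G, a ∈ P → a⁻¹ ∈ P → a = 1
  /-- Any two elements have a greatest common divisor with respect to `≼`. -/
  exists_gcd : ∀ a b : G, ∃ d : G, d⁻¹ * a ∈ P ∧ d⁻¹ * b ∈ P ∧
    ∀ c : G, c⁻¹ * a ∈ P → c⁻¹ * b ∈ P → c⁻¹ * d ∈ P
  /-- Any two elements have a least common multiple with respect to `≼`. -/
  exists_lcm : ∀ a b : G, ∃ m : G, a⁻¹ * m ∈ P ∧ b⁻¹ * m ∈ P ∧
    ∀ c : G, a⁻¹ * c ∈ P → b⁻¹ * c ∈ P → m⁻¹ * c ∈ P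
  /-- The interval `[1, Δ]` generates `G`. -/
  closure_simples : Subgroup.closure {s : G | (1 : G)⁻¹ * s ∈ P ∧ s⁻¹ * Δ ∈ P} = ⊤
  /-- `Δ⁻¹ P Δ = P`. -/
  conj_Δ : (fun a : G => Δ⁻¹ * a * Δ) '' (P : Set G) = (P : Set G)
  /-- For every nontrivial positive element, the lengths of its decompositions into nontrivial
  positive factors are bounded. -/
  norm_finite : ∀ x : G, x ∈ P → x ≠ 1 →
    BddAbove {k : ℕ | ∃ l : List G, l.length = k ∧ (∀ a ∈ l, a ∈ P ∧ a ≠ 1) ∧ l.prod = x}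

namespace GarsideStructure

variable {G : Type*} [Group G] (D : GarsideStructure G)

/-- The order `a ≼ b`. -/
def Le (a b : G) : Prop := a⁻¹ * b ∈ D.P

/-- The greatest common divisor `a ∧ b` with respect to `≼`. -/
noncomputable def meet (a b : G) : G := (D.exists_gcd a b).choose

/-- The set `[1, Δ]` of simple elements. -/
def simples : Set G := {s | D.Le 1 s ∧ D.Le s D.Δ}

/-- The Garside structure is of finite type if `[1, Δ]` is finite. -/
def FiniteType : Prop := D.simples.Finite

/-- The atoms: nontrivial positive elements that cannot be decomposed in `P`. -/
def atoms : Set G :=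
  {a | a ∈ D.P ∧ a ≠ 1 ∧ ∀ b c : G, b ∈ D.P → c ∈ D.P → a = b * c → b = 1 ∨ c = 1}

/-- The right complement `∂(s) = s⁻¹ Δ`. -/
def rightComplement (s : G) : G := s⁻¹ * D.Δ

/-- The decomposition `a · b` is left weighted: `∂(a) ∧ b = 1`. -/
def LeftWeighted (a b : G) : Prop := D.meet (D.rightComplement a) b = 1

/-- `x = Δ ^ p * x₁ * ⋯ * xᵣ` (with `l = [x₁, …, xᵣ]`) is the left normal form of `x`. -/
def IsLeftNormalForm (p : ℤ) (l : List G) (x : G) : Prop :=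
  x = D.Δ ^ p * l.prod ∧ (∀ s ∈ l, s ∈ D.simples ∧ s ≠ 1 ∧ s ≠ D.Δ) ∧
    List.IsChain D.LeftWeighted l

/-- The infimum of `x`: the exponent `p` of `Δ` in the left normal form of `x`. -/
noncomputable def infimum (x : G) : ℤ :=
  Classical.epsilon fun p : ℤ => ∃ l : List G, D.IsLeftNormalForm p l x

/-- The initial factor `ι(x) = x Δ ^ (-inf x) ∧ Δ`. -/
noncomputable def initialFactor (x : G) : G := D.meet (x * D.Δ ^ (-D.infimum x)) D.Δ

/-- The preferred prefix `𝔭(x) = ι(x) ∧ ι(x⁻¹)`. -/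
noncomputable def preferredPrefix (x : G) : G :=
  D.meet (D.initialFactor x) (D.initialFactor x⁻¹)

/-- The cyclic sliding `𝔰(x) = 𝔭(x)⁻¹ x 𝔭(x)`. -/
noncomputable def cyclicSliding (x : G) : G :=
  (D.preferredPrefix x)⁻¹ * x * D.preferredPrefix x

/-- The set of sliding circuits `SC(x)`: the conjugates `y` of `x` with `𝔰 ^ m (y) = y` for some
`m ≥ 1`. -/
def SC (x : G) : Set G := {y | IsConj x y ∧ ∃ m : ℕ, 1 ≤ m ∧ D.cyclicSliding^[m] y = y}

/-- `s` is an indecomposable conjugator starting at `y` (with respect to `SC(x)`). -/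
def IsIndecomposableConjugator (x y s : G) : Prop :=
  s ∈ D.P ∧ s ≠ 1 ∧ s⁻¹ * y * s ∈ D.SC x ∧
    ¬ ∃ s₁ s₂ : G, s₁ ∈ D.P ∧ s₂ ∈ D.P ∧ s₁ ≠ 1 ∧ s₂ ≠ 1 ∧ s = s₁ * s₂ ∧
      s₁⁻¹ * y * s₁ ∈ D.SC x

/-- The vertex type of the sliding circuits graph of `x`. -/
def SCG (x : G) : Type _ := {y : G // y ∈ D.SC x}

/-- The sliding circuits graph as a directed multigraph: an arrow from `y` to `z` is an
indecomposable conjugator `s` starting at `y` with `y ^ s = z`. -/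
instance SCG.quiver (x : G) : Quiver (D.SCG x) where
  Hom y z := {s : G // D.IsIndecomposableConjugator x y.1 s ∧ s⁻¹ * y.1 * s = z.1}

end GarsideStructure

/-!
The order `≼` of a Garside structure of finite type makes the group a meet-semilattice on which left
multiplication by any element and right multiplication by `Δ` act by automorphisms, and whose
intervals are finite (`isGarsideElement`). The whole argument takes place in this order. Below,
`y ^ β` stands for `β⁻¹ y β`.

The main tool is the sliding operator `F β = y β Δ⁻ᵖ ⊓ y⁻¹ β Δ⁻ᵖ' ⊓ β Δ` (`slideOp`), where `p` and
`p'` are the infima of `y` and `y⁻¹`. It preserves meets, it commutes with right multiplication by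
`Δ` and with left multiplication by the centralizer of `y`, and as long as the infima do not change,
`F β` is `β` times the preferred prefix of `y ^ β`. Iterated sliding of `y ^ β` is therefore
conjugation of `y` by iterates of `F` at `β` (`iterate_slide_conj`).

*Sliding circuits have maximal infimum* (`infimum_le_of_periodic`). Put `T β = y β Δ⁻ᵖ⁻¹` and
`S β = y⁻¹ β Δ⁻ᵖ'⁻¹`, so that `F β = (β ⊓ T β ⊓ S β) Δ`, and `Δ ^ (p + 1) ≼ y ^ β` means `β ≼ T β`.
If `γ ≼ T γ` for some `γ`, then the iterates of `β ↦ β ⊓ T β` at `1` are bounded below, hence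
stabilise. When `β ≼ T (S β)`, the iterates of `F` split into those for `T` and those for `S`, and
it follows that `T` enlarges a high iterate `F^k 1`: after `k` slidings the infimum exceeds `p`.
When `β ≼ T (S β)` fails, `y` has canonical length at most one and the same stabilisation forces `y = Δ ^ (p + 1)`. Consequently all elements of `SC(x)` share the infimum and
the supremum, and `SC(x)` is finite; it is nonempty because iterated sliding stays in a finite set.

*Closure under meets* (`exists_periodic_conj_inf`). If `y` and `y ^ α` lie on sliding circuits, then
`α ↦ F^N(1)⁻¹ F^N(α)` permutes, for a suitable `N`, the conjugators from `y` to `y ^ α` in a finite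
interval, so some iterate `F^n` maps `α` to `F^n(1) α`. This condition passes to meets because `F^n`
preserves them.

Closure under meets and under conjugation by `Δ` gives everything else: an indecomposable conjugator
`s` equals `s ⊓ Δ`, so it is simple; two indecomposable conjugators with a common atom as prefix
equal their meet; and a positive conjugator between two elements of `SC(x)` factors into
indecomposable ones because intervals are finite.
-/

/-! ### Meet-preserving maps on a semilattice -/

section Semilattice

variable {L : Type*} [SemilatticeInf L] {S T : L → L}

theorem iterate_inf_self_le (T : L → L) (k : ℕ) (e : L) :
    (fun a => a ⊓ T a)^[k] e ≤ e := by
  induction k with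
  | zero => exact le_rfl
  | succ k ih => rw [Function.iterate_succ_apply']; exact inf_le_left.trans ih

theorem iterate_succ_inf_self_le (hT : ∀ a b, T (a ⊓ b) = T a ⊓ T b) (k : ℕ) (e : L) :
    (fun a => a ⊓ T a)^[k + 1] e ≤ T e := by
  have hmono : Monotone T := fun a b hab => by
    have := hT a b
    rw [inf_eq_left.2 hab] at this
    exact inf_eq_left.1 this.symm
  rw [Function.iterate_succ_apply']
  exact inf_le_right.trans (hmono (iterate_inf_self_le T k e))

theorem inf_iterate_inf_self_le_map (hT : ∀ a b, T (a ⊓ b) = T a ⊓ T b)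
    (hTS : ∀ a, a ≤ T (S a)) (k : ℕ) (e : L) :
    T e ⊓ (fun a => a ⊓ S a)^[k] e ≤ T ((fun a => a ⊓ S a)^[k] e) := by
  induction k with
  | zero => exact inf_le_left
  | succ k ih =>
    rw [Function.iterate_succ_apply']
    set a := (fun a => a ⊓ S a)^[k] e
    have h : T (a ⊓ S a) = T a ⊓ T (S a) := hT _ _
    refine le_of_le_of_eq (le_inf ?_ ?_) h.symm
    · exact (inf_le_inf_left _ inf_le_left).trans ih
    · exact (inf_le_right.trans inf_le_left).trans (hTS a)

/-- When `S` and `T` are inverse to one another up to enlarging, iterating `a ↦ a ⊓ T a ⊓ S a`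
amounts to iterating `a ↦ a ⊓ T a` and `a ↦ a ⊓ S a` separately. -/
theorem iterate_inf_inf_eq (hT : ∀ a b, T (a ⊓ b) = T a ⊓ T b)
    (hS : ∀ a b, S (a ⊓ b) = S a ⊓ S b) (hTS : ∀ a, a ≤ T (S a)) (hST : ∀ a, a ≤ S (T a))
    (k : ℕ) (e : L) :
    (fun a => a ⊓ T a ⊓ S a)^[k] e = (fun a => a ⊓ T a)^[k] e ⊓ (fun a => a ⊓ S a)^[k] e := by
  induction k with
  | zero => simp
  | succ k ih =>
    have h1 := inf_iterate_inf_self_le_map hT hTS k e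
    have h2 := inf_iterate_inf_self_le_map hS hST k e
    have h3 := iterate_succ_inf_self_le hT k e
    have h4 := iterate_succ_inf_self_le hS k e
    rw [Function.iterate_succ_apply'] at h3 h4
    rw [Function.iterate_succ_apply', ih, Function.iterate_succ_apply',
      Function.iterate_succ_apply']
    set t := (fun a => a ⊓ T a)^[k] e
    set s := (fun a => a ⊓ S a)^[k] e
    change t ⊓ T t ≤ T e at h3
    change s ⊓ S s ≤ S e at h4
    change t ⊓ s ⊓ T (t ⊓ s) ⊓ S (t ⊓ s) = t ⊓ T t ⊓ (s ⊓ S s)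
    rw [hT, hS]
    have h5 : t ⊓ T t ⊓ (s ⊓ S s) ≤ T s :=
      le_trans (le_inf (inf_le_left.trans h3) (inf_le_right.trans inf_le_left)) h1
    have h6 : t ⊓ T t ⊓ (s ⊓ S s) ≤ S t :=
      le_trans (le_inf (inf_le_right.trans h4) (inf_le_left.trans inf_le_left)) h2
    apply le_antisymm
    · simp only [le_inf_iff]
      refine ⟨⟨?_, ?_⟩, ?_, ?_⟩
      · exact (inf_le_left.trans inf_le_left).trans inf_le_left
      · exact (inf_le_left.trans inf_le_right).trans inf_le_left
      · exact (inf_le_left.trans inf_le_left).trans inf_le_right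
      · exact inf_le_right.trans inf_le_right
    · refine le_inf (le_inf (le_inf ?_ ?_) (le_inf ?_ h5)) (le_inf h6 ?_)
      · exact inf_le_left.trans inf_le_left
      · exact inf_le_right.trans inf_le_left
      · exact inf_le_left.trans inf_le_right
      · exact inf_le_right.trans inf_le_right

/-- Once the iterates of `a ↦ a ⊓ T a` at `e` are stationary, `T` enlarges the iterates of
`a ↦ a ⊓ T a ⊓ S a` as well. -/
theorem iterate_inf_inf_le_map (hT : ∀ a b, T (a ⊓ b) = T a ⊓ T b)
    (hS : ∀ a b, S (a ⊓ b) = S a ⊓ S b) (hTS : ∀ a, a ≤ T (S a)) (hST : ∀ a, a ≤ S (T a))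
    {k : ℕ} {e : L} (hk : (fun a => a ⊓ T a)^[k + 1] e = (fun a => a ⊓ T a)^[k] e) :
    (fun a => a ⊓ T a ⊓ S a)^[k] e ≤ T ((fun a => a ⊓ T a ⊓ S a)^[k] e) := by
  rw [iterate_inf_inf_eq hT hS hTS hST, hT]
  have h1 := inf_iterate_inf_self_le_map hT hTS k e
  have h3 := iterate_succ_inf_self_le hT k e
  rw [hk] at h3
  rw [Function.iterate_succ_apply'] at hk
  exact le_inf (inf_le_left.trans (inf_eq_left.1 hk))
    ((le_inf (inf_le_left.trans h3) inf_le_right).trans h1)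

theorem exists_succ_eq_of_antitone {u : ℕ → L} (hu : Antitone u) {t : Set L} (ht : t.Finite)
    (hut : ∀ n, u n ∈ t) : ∃ k, u (k + 1) = u k := by
  obtain ⟨a, b, hab, h⟩ := Set.Finite.exists_lt_map_eq_of_forall_mem hut ht
  exact ⟨a, le_antisymm (hu (Nat.le_succ a)) (h.le.trans (hu hab))⟩

end Semilattice

/-! ### Left-invariant semilattice orders with a Garside element -/

/-- A Garside element of finite type of a group with a left-invariant meet-semilattice order:
right multiplication by `Δ` is an order automorphism, the powers of `Δ` are cofinal, and the
interval `[1, Δ]` is finite. -/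
structure IsGarsideElement {G : Type*} [Group G] [SemilatticeInf G] (Δ : G) : Prop where
  mul_left_le : ∀ a b c : G, b ≤ c → a * b ≤ a * c
  one_le : 1 ≤ Δ
  mul_le_mul : ∀ a b : G, a ≤ b → a * Δ ≤ b * Δ
  mul_inv_le_mul_inv : ∀ a b : G, a ≤ b → a * Δ⁻¹ ≤ b * Δ⁻¹
  exists_le_pow : ∀ x : G, ∃ n : ℕ, x ≤ Δ ^ n
  finite_Icc : (Set.Icc 1 Δ).Finite

namespace IsGarsideElement

variable {G : Type*} [Group G] [SemilatticeInf G] {Δ : G} (h : IsGarsideElement Δ)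

include h

theorem mul_left_le_iff (a : G) {b c : G} : a * b ≤ a * c ↔ b ≤ c :=
  ⟨fun H => by simpa using h.mul_left_le a⁻¹ _ _ H, h.mul_left_le a b c⟩

theorem mul_inf (a b c : G) : a * (b ⊓ c) = a * b ⊓ a * c := by
  apply le_antisymm
  · exact le_inf (h.mul_left_le _ _ _ inf_le_left) (h.mul_left_le _ _ _ inf_le_right)
  · rw [← h.mul_left_le_iff a⁻¹, inv_mul_cancel_left]
    refine le_inf ?_ ?_ <;> rw [← h.mul_left_le_iff a, mul_inv_cancel_left]
    exacts [inf_le_left, inf_le_right]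

theorem mul_zpow_le {a b : G} (hab : a ≤ b) (k : ℤ) : a * Δ ^ k ≤ b * Δ ^ k := by
  induction k with
  | zero => simpa
  | succ n ih => simpa only [zpow_add_one, ← mul_assoc] using h.mul_le_mul _ _ ih
  | pred n ih => simpa only [zpow_sub_one, ← mul_assoc] using h.mul_inv_le_mul_inv _ _ ih

theorem mul_zpow_le_iff {a b : G} (k : ℤ) : a * Δ ^ k ≤ b * Δ ^ k ↔ a ≤ b :=
  ⟨fun H => by simpa [mul_assoc] using h.mul_zpow_le H (-k), fun H => h.mul_zpow_le H k⟩

theorem inf_mul_zpow (a b : G) (k : ℤ) : (a ⊓ b) * Δ ^ k = a * Δ ^ k ⊓ b * Δ ^ k := by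
  apply le_antisymm
  · exact le_inf (h.mul_zpow_le inf_le_left k) (h.mul_zpow_le inf_le_right k)
  · rw [← h.mul_zpow_le_iff (-k), mul_assoc, ← zpow_add, add_neg_cancel, zpow_zero, mul_one]
    refine le_inf ?_ ?_ <;>
      rw [← h.mul_zpow_le_iff k, mul_assoc, ← zpow_add, neg_add_cancel, zpow_zero, mul_one]
    exacts [inf_le_left, inf_le_right]

theorem le_mul_iff {a b : G} : a ≤ a * b ↔ 1 ≤ b := by
  rw [← h.mul_left_le_iff a (b := 1), mul_one]

theorem one_le_mul {a b : G} (ha : 1 ≤ a) (hb : 1 ≤ b) : 1 ≤ a * b :=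
  ha.trans (h.le_mul_iff.2 hb)

theorem one_le_inv_mul {a b : G} : 1 ≤ a⁻¹ * b ↔ a ≤ b := by
  rw [← h.mul_left_le_iff a (b := 1), mul_one, mul_inv_cancel_left]

theorem one_le_pow (n : ℕ) : 1 ≤ Δ ^ n := by
  induction n with
  | zero => simp
  | succ n ih => rw [pow_succ]; exact h.one_le_mul ih h.one_le

theorem zpow_mono {j k : ℤ} (hjk : j ≤ k) : Δ ^ j ≤ Δ ^ k := by
  obtain ⟨n, rfl⟩ := Int.le.dest hjk
  rw [zpow_add, h.le_mul_iff, zpow_natCast]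
  exact h.one_le_pow n

theorem zpow_le_conj_iff (y β : G) (k : ℤ) : Δ ^ k ≤ β⁻¹ * y * β ↔ β ≤ y * β * Δ ^ (-k) := by
  rw [← h.mul_left_le_iff β, ← h.mul_zpow_le_iff (-k)]
  simp [mul_assoc]

theorem zpow_neg_le_inv_iff (x : G) (k : ℤ) : Δ ^ (-k) ≤ x⁻¹ ↔ x ≤ Δ ^ k := by
  rw [← h.mul_left_le_iff x, ← h.mul_zpow_le_iff k]
  simp [mul_assoc]

theorem exists_zpow_neg_le (x : G) : ∃ n : ℕ, Δ ^ (-(n : ℤ)) ≤ x := by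
  obtain ⟨n, hn⟩ := h.exists_le_pow x⁻¹
  refine ⟨n, ?_⟩
  have := (h.zpow_neg_le_inv_iff x⁻¹ n).2 (by simpa using hn)
  simpa using this

theorem zpow_le_conj_zpow_iff (x : G) (k m : ℤ) :
    Δ ^ k ≤ (Δ ^ m)⁻¹ * x * Δ ^ m ↔ Δ ^ k ≤ x := by
  rw [← h.mul_left_le_iff (Δ ^ m), ← h.mul_zpow_le_iff (-m)]
  simp only [mul_assoc, ← zpow_add, mul_inv_cancel_left]
  simp

/-- Splitting off the simple factor `x ⊓ Δ` lowers the power of `Δ` that bounds `x`. -/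
theorem inf_inv_mul_le_pow {x : G} {n : ℕ} (hn : x ≤ Δ ^ (n + 1)) :
    (x ⊓ Δ)⁻¹ * x ≤ Δ ^ n := by
  rw [← h.mul_left_le_iff (x ⊓ Δ), mul_inv_cancel_left]
  have := h.inf_mul_zpow x Δ n
  rw [zpow_natCast] at this
  rw [this, ← pow_succ']
  exact le_inf (h.le_mul_iff.2 (h.one_le_pow n)) hn

theorem eq_one_of_inf_eq_one {x : G} (hx : 1 ≤ x) (hΔ : x ⊓ Δ = 1) : x = 1 := by
  obtain ⟨n, hn⟩ := h.exists_le_pow x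
  induction n with
  | zero => exact le_antisymm (by simpa using hn) hx
  | succ n ih => exact ih (by simpa [hΔ] using h.inf_inv_mul_le_pow hn)

theorem finite_Icc_one_pow (n : ℕ) : (Set.Icc 1 (Δ ^ n)).Finite := by
  induction n with
  | zero => simp
  | succ n ih =>
    refine (Set.Finite.image2 (fun a b => a * b) h.finite_Icc ih).subset ?_
    rintro x ⟨hx, hn⟩
    exact ⟨x ⊓ Δ, ⟨le_inf hx h.one_le, inf_le_right⟩, (x ⊓ Δ)⁻¹ * x,
      ⟨h.one_le_inv_mul.2 inf_le_left, h.inf_inv_mul_le_pow hn⟩, mul_inv_cancel_left _ _⟩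

theorem finite_Icc_any (a b : G) : (Set.Icc a b).Finite := by
  obtain ⟨n, hn⟩ := h.exists_le_pow (a⁻¹ * b)
  refine ((h.finite_Icc_one_pow n).image (fun c => a * c)).subset ?_
  rintro x ⟨hx, hxb⟩
  exact ⟨a⁻¹ * x, ⟨h.one_le_inv_mul.2 hx, (h.mul_left_le _ _ _ hxb).trans hn⟩,
    mul_inv_cancel_left _ _⟩

end IsGarsideElement

/-! ### Cyclic sliding -/

section Sliding

variable {G : Type*} [Group G] [SemilatticeInf G]

/-- The preferred prefix, relative to a function `i` that plays the role of the infimum. -/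
def prefPrefix (Δ : G) (i : G → ℤ) (x : G) : G :=
  (x * Δ ^ (-i x) ⊓ Δ) ⊓ (x⁻¹ * Δ ^ (-i x⁻¹) ⊓ Δ)

/-- Cyclic sliding: conjugation by the preferred prefix. -/
def slide (Δ : G) (i : G → ℤ) (x : G) : G := (prefPrefix Δ i x)⁻¹ * x * prefPrefix Δ i x

/-- The operator `β ↦ y β Δ⁻ᵖ ⊓ y⁻¹ β Δ⁻ᵖ' ⊓ β Δ`, with the meet written in the shape of
`prefPrefix`. When `y ^ β` and its inverse have infima `p` and
`p'`, it multiplies `β` by the preferred prefix of `y ^ β`. -/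
def slideOp (Δ y : G) (p p' : ℤ) (β : G) : G :=
  (y * β * Δ ^ (-p) ⊓ β * Δ) ⊓ (y⁻¹ * β * Δ ^ (-p') ⊓ β * Δ)

/-- `i x` is the largest exponent `k` with `Δ ^ k ≤ x`. -/
def IsInfimum (Δ : G) (i : G → ℤ) : Prop := ∀ x k, Δ ^ k ≤ x ↔ k ≤ i x

variable {Δ : G} {i : G → ℤ}

theorem prefPrefix_inv (x : G) : prefPrefix Δ i x⁻¹ = prefPrefix Δ i x := by
  simp only [prefPrefix, inv_inv, inf_comm]

theorem slide_inv (x : G) : slide Δ i x⁻¹ = (slide Δ i x)⁻¹ := by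
  simp only [slide, prefPrefix_inv, mul_inv_rev, inv_inv, mul_assoc]

theorem iterate_slide_inv (k : ℕ) (x : G) : (slide Δ i)^[k] x⁻¹ = ((slide Δ i)^[k] x)⁻¹ := by
  induction k with
  | zero => rfl
  | succ k ih => rw [Function.iterate_succ_apply', ih, slide_inv, Function.iterate_succ_apply']

theorem isConj_slide (x : G) : IsConj x (slide Δ i x) :=
  isConj_iff.2 ⟨(prefPrefix Δ i x)⁻¹, by simp [slide]⟩

theorem isConj_iterate_slide (k : ℕ) (x : G) : IsConj x ((slide Δ i)^[k] x) := by
  induction k with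
  | zero => exact IsConj.refl x
  | succ k ih => rw [Function.iterate_succ_apply']; exact ih.trans (isConj_slide _)

theorem slideOp_mul_left {v y : G} (hv : Commute v y) (p p' : ℤ) (h : IsGarsideElement Δ) (β : G) :
    slideOp Δ y p p' (v * β) = v * slideOp Δ y p p' β := by
  have h1 : y * (v * β) = v * (y * β) := by rw [← mul_assoc, ← hv.eq, mul_assoc]
  have h2 : y⁻¹ * (v * β) = v * (y⁻¹ * β) := by
    rw [← mul_assoc, ← hv.inv_right.eq, mul_assoc]
  simp only [slideOp, h1, h2, h.mul_inf, mul_assoc]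

theorem iterate_slideOp_mul_left {v y : G} (hv : Commute v y) (p p' : ℤ) (h : IsGarsideElement Δ)
    (k : ℕ) (β : G) :
    (slideOp Δ y p p')^[k] (v * β) = v * (slideOp Δ y p p')^[k] β :=
  ((show Function.Commute (slideOp Δ y p p') (v * ·) from
    slideOp_mul_left hv p p' h).iterate_left k) β

namespace IsGarsideElement

variable (h : IsGarsideElement Δ)

include h

theorem slideOp_inf (y : G) (p p' : ℤ) (a b : G) :
    slideOp Δ y p p' (a ⊓ b) = slideOp Δ y p p' a ⊓ slideOp Δ y p p' b := by
  have h1 := h.inf_mul_zpow a b 1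
  rw [zpow_one] at h1
  simp only [slideOp, h.mul_inf, h.inf_mul_zpow, h1]
  ac_rfl

theorem iterate_slideOp_inf (y : G) (p p' : ℤ) (k : ℕ) (a b : G) :
    (slideOp Δ y p p')^[k] (a ⊓ b) = (slideOp Δ y p p')^[k] a ⊓ (slideOp Δ y p p')^[k] b := by
  induction k with
  | zero => rfl
  | succ k ih => simp only [Function.iterate_succ_apply', ih, h.slideOp_inf]

theorem slideOp_mul_zpow (y : G) (p p' : ℤ) (β : G) (m : ℤ) :
    slideOp Δ y p p' (β * Δ ^ m) = slideOp Δ y p p' β * Δ ^ m := by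
  simp only [slideOp, h.inf_mul_zpow, mul_assoc, ← zpow_add, ← zpow_one_add, ← zpow_add_one,
    add_comm]

theorem iterate_slideOp_mul_zpow (y : G) (p p' : ℤ) (k : ℕ) (β : G) (m : ℤ) :
    (slideOp Δ y p p')^[k] (β * Δ ^ m) = (slideOp Δ y p p')^[k] β * Δ ^ m :=
  ((show Function.Commute (slideOp Δ y p p') (· * Δ ^ m) from
    fun β => h.slideOp_mul_zpow y p p' β m).iterate_left k) β

theorem slideOp_eq {y β : G} {p p' : ℤ} (hp : i (β⁻¹ * y * β) = p)
    (hp' : i (β⁻¹ * y * β)⁻¹ = p') :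
    slideOp Δ y p p' β = β * prefPrefix Δ i (β⁻¹ * y * β) := by
  simp only [slideOp, prefPrefix, hp, hp', h.mul_inf]
  simp [mul_assoc]

theorem iterate_slide_conj {y β : G} {p p' : ℤ} (k : ℕ)
    (hp : ∀ j < k, i ((slide Δ i)^[j] (β⁻¹ * y * β)) = p)
    (hp' : ∀ j < k, i ((slide Δ i)^[j] (β⁻¹ * y * β))⁻¹ = p') :
    (slide Δ i)^[k] (β⁻¹ * y * β) =
      ((slideOp Δ y p p')^[k] β)⁻¹ * y * (slideOp Δ y p p')^[k] β := by
  induction k with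
  | zero => rfl
  | succ k ih =>
    have e := ih (fun j hj => hp j (by omega)) (fun j hj => hp' j (by omega))
    have h1 := hp k (by omega)
    have h2 := hp' k (by omega)
    rw [e] at h1 h2
    rw [Function.iterate_succ_apply', e, Function.iterate_succ_apply', h.slideOp_eq h1 h2, slide]
    group

/-- For an iterate `Φ` of the sliding operator, the conjugator `β⁻¹ * Φ β` depends on the conjugate
`y ^ β` only. -/
theorem iterate_slideOp_mul_right {y β w : G} {p p' : ℤ} (k : ℕ)
    (hw : Commute w (β⁻¹ * y * β)) :
    (slideOp Δ y p p')^[k] (β * w) = β * w * (β⁻¹ * (slideOp Δ y p p')^[k] β) := by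
  have hv : Commute (β * w * β⁻¹) y := by
    have := hw.eq
    show β * w * β⁻¹ * y = y * (β * w * β⁻¹)
    calc β * w * β⁻¹ * y = β * (w * (β⁻¹ * y * β)) * β⁻¹ := by group
      _ = _ := by rw [this]; group
  have e : β * w = (β * w * β⁻¹) * β := by group
  rw [e, iterate_slideOp_mul_left hv p p' h]
  group

section

variable (hi : IsInfimum Δ i)

include hi

/-- A lower bound on the infimum of `y ^ β` is an inequality between two values of order
automorphisms at `β`; this makes such conditions stable under meets. -/
theorem le_infimum_conj_iff (y β : G) (k : ℤ) :
    k ≤ i (β⁻¹ * y * β) ↔ β ≤ y * β * Δ ^ (-k) := by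
  rw [← hi, h.zpow_le_conj_iff]

theorem infimum_conj_zpow (x : G) (m : ℤ) : i ((Δ ^ m)⁻¹ * x * Δ ^ m) = i x :=
  eq_of_forall_le_iff fun k => by rw [← hi, h.zpow_le_conj_zpow_iff, hi]

theorem infimum_conj_mul_zpow (x β : G) (m : ℤ) :
    i ((β * Δ ^ m)⁻¹ * x * (β * Δ ^ m)) = i (β⁻¹ * x * β) := by
  rw [← h.infimum_conj_zpow hi (β⁻¹ * x * β) m]
  simp only [mul_inv_rev, mul_assoc]

theorem le_infimum_conj_inf {y a b : G} {k : ℤ} (ha : k ≤ i (a⁻¹ * y * a))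
    (hb : k ≤ i (b⁻¹ * y * b)) : k ≤ i ((a ⊓ b)⁻¹ * y * (a ⊓ b)) := by
  rw [h.le_infimum_conj_iff hi] at ha hb ⊢
  rw [h.mul_inf, h.inf_mul_zpow]
  exact inf_le_inf ha hb

/-- The preferred prefix is a meet of elements that commute with `x` up to a power of `Δ`, and
conjugation by these does not change the infimum. -/
theorem infimum_le_slide (x : G) : i x ≤ i (slide Δ i x) := by
  have hΔ := h.infimum_conj_zpow hi x 1
  rw [zpow_one] at hΔ
  refine h.le_infimum_conj_inf hi (h.le_infimum_conj_inf hi ?_ hΔ.ge)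
    (h.le_infimum_conj_inf hi ?_ hΔ.ge)
  · rw [h.infimum_conj_mul_zpow hi]; simp
  · rw [h.infimum_conj_mul_zpow hi]; simp

theorem infimum_iterate_slide_mono (x : G) : Monotone fun k => i ((slide Δ i)^[k] x) :=
  monotone_nat_of_le_succ fun k => by
    rw [Function.iterate_succ_apply']; exact h.infimum_le_slide hi _

theorem infimum_iterate_slide_eq {x : G} {m : ℕ} (hm : 1 ≤ m) (hx : (slide Δ i)^[m] x = x)
    (k : ℕ) : i ((slide Δ i)^[k] x) = i x := by
  apply le_antisymm
  · have h1 : (slide Δ i)^[m * k] x = x := (Function.IsPeriodicPt.mul_const hx k)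
    calc _ ≤ i ((slide Δ i)^[m * k] x) :=
          h.infimum_iterate_slide_mono hi x (Nat.le_mul_of_pos_left k hm)
      _ = _ := by rw [h1]
  · exact h.infimum_iterate_slide_mono hi x (Nat.zero_le k)

/-- The infimum of the inverse is minus the supremum, so the supremum is constant along a circuit
too. -/
theorem infimum_inv_iterate_slide_eq {x : G} {m : ℕ} (hm : 1 ≤ m) (hx : (slide Δ i)^[m] x = x)
    (k : ℕ) : i ((slide Δ i)^[k] x)⁻¹ = i x⁻¹ := by
  rw [← iterate_slide_inv]
  exact h.infimum_iterate_slide_eq hi hm (by rw [iterate_slide_inv, hx]) k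

theorem finite_le_infimum (p p' : ℤ) : {x : G | p ≤ i x ∧ p' ≤ i x⁻¹}.Finite := by
  refine (h.finite_Icc_any (Δ ^ p) (Δ ^ (-p'))).subset ?_
  rintro x ⟨h1, h2⟩
  rw [← hi] at h1 h2
  exact ⟨h1, (h.zpow_neg_le_inv_iff x (-p')).1 (by simpa using h2)⟩

theorem exists_iterate_slide_periodic (x : G) :
    ∃ k m : ℕ, 1 ≤ m ∧ (slide Δ i)^[m] ((slide Δ i)^[k] x) = (slide Δ i)^[k] x := by
  obtain ⟨a, b, hab, e⟩ := Set.Finite.exists_lt_map_eq_of_forall_mem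
    (f := fun k => (slide Δ i)^[k] x) (t := {y : G | i x ≤ i y ∧ i x⁻¹ ≤ i y⁻¹})
    (fun k => ⟨h.infimum_iterate_slide_mono hi x (Nat.zero_le k), by
      rw [← iterate_slide_inv]
      exact h.infimum_iterate_slide_mono hi x⁻¹ (Nat.zero_le k)⟩) (h.finite_le_infimum hi _ _)
  refine ⟨a, b - a, by omega, ?_⟩
  rw [← Function.iterate_add_apply, Nat.sub_add_cancel hab.le]
  exact e.symm

/-- An element of a sliding circuit has maximal infimum in its conjugacy class. -/
theorem infimum_le_of_periodic {y : G} {m : ℕ} (hm : 1 ≤ m) (hy : (slide Δ i)^[m] y = y) (γ : G) :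
    i (γ⁻¹ * y * γ) ≤ i y := by
  by_contra! hlt
  set p := i y with hp
  set p' := i y⁻¹ with hp'
  have hγ : γ ≤ y * γ * Δ ^ (-(p + 1)) := by
    rw [← h.le_infimum_conj_iff hi]; omega
  obtain ⟨n, hn⟩ := h.exists_le_pow γ
  -- Right multiplication by powers of `Δ` does not change the condition on `γ`.
  set δ := γ * Δ ^ (-(n : ℤ)) with hδ
  have hδ1 : δ ≤ 1 := by
    rw [hδ, ← h.mul_zpow_le_iff n]; simpa [mul_assoc] using hn
  set T : G → G := fun β => y * β * Δ ^ (-(p + 1)) with hTdef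
  set S : G → G := fun β => y⁻¹ * β * Δ ^ (-(p' + 1)) with hSdef
  have hTδ : δ ≤ T δ := by
    have := h.mul_zpow_le hγ (-(n : ℤ))
    refine this.trans_eq ?_
    simp only [hTdef, hδ, mul_assoc, ← zpow_add, add_comm]
  have hT : ∀ a b, T (a ⊓ b) = T a ⊓ T b := fun a b => by
    simp only [hTdef, h.mul_inf, h.inf_mul_zpow]
  have hS : ∀ a b, S (a ⊓ b) = S a ⊓ S b := fun a b => by
    simp only [hSdef, h.mul_inf, h.inf_mul_zpow]
  have hTmono : Monotone T := fun a b hab => h.mul_zpow_le (h.mul_left_le _ _ _ hab) _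
  have hTS : ∀ a, T (S a) = a * Δ ^ (-(p + p' + 2)) := fun a => by
    simp only [hTdef, hSdef, mul_assoc, mul_inv_cancel_left, ← zpow_add]
    congr 2; ring
  have hST : ∀ a, S (T a) = a * Δ ^ (-(p + p' + 2)) := fun a => by
    simp only [hTdef, hSdef, mul_assoc, inv_mul_cancel_left, ← zpow_add]
    congr 2; ring
  -- `β ↦ β ⊓ T β` decreases but stays above `δ`, so its iterates at `1` stabilise.
  have hδk : ∀ k, δ ≤ (fun a => a ⊓ T a)^[k] 1 := fun k => by
    induction k with
    | zero => exact hδ1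
    | succ k ih =>
      rw [Function.iterate_succ_apply']
      exact le_inf ih (hTδ.trans (hTmono ih))
  obtain ⟨k, hk⟩ := exists_succ_eq_of_antitone (u := fun k => (fun a => a ⊓ T a)^[k] 1)
    (antitone_nat_of_succ_le fun k => by
      rw [Function.iterate_succ_apply']; exact inf_le_left)
    (h.finite_Icc_any δ 1) fun k => ⟨hδk k, iterate_inf_self_le T k 1⟩
  -- The canonical length of `y` is `-(p + p')`.
  rcases le_or_gt (p + p' + 2) 0 with hr | hr
  · have hge : ∀ a : G, a ≤ a * Δ ^ (-(p + p' + 2)) := fun a => by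
      rw [h.le_mul_iff, ← zpow_zero Δ]; exact h.zpow_mono (by omega)
    have key := iterate_inf_inf_le_map hT hS (fun a => (hge a).trans_eq (hTS a).symm)
      (fun a => (hge a).trans_eq (hST a).symm) hk
    -- `β ↦ β ⊓ T β ⊓ S β` is the sliding operator up to a power of `Δ`.
    have hF : ∀ j, (slideOp Δ y p p')^[j] 1 =
        (fun a => a ⊓ T a ⊓ S a)^[j] 1 * Δ ^ (j : ℤ) := fun j => by
      induction j with
      | zero => simp
      | succ j ih =>
        rw [Function.iterate_succ_apply', ih, h.slideOp_mul_zpow, Function.iterate_succ_apply']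
        set b := (fun a => a ⊓ T a ⊓ S a)^[j] 1
        have e : slideOp Δ y p p' b = (b ⊓ T b ⊓ S b) * Δ ^ (1 : ℤ) := by
          simp only [slideOp, h.inf_mul_zpow, hTdef, hSdef, mul_assoc, ← zpow_add]
          simp only [neg_add, neg_add_cancel_right, zpow_one]
          apply le_antisymm <;> simp only [le_inf_iff] <;>
            simp only [inf_assoc, inf_le_left, and_self, inf_le_of_right_le, le_refl]
        rw [e, mul_assoc, ← zpow_add]
        push_cast
        rw [add_comm (1 : ℤ)]
    have hsl := h.iterate_slide_conj (i := i) (y := y) (β := 1) (p := p) (p' := p') k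
      (fun j _ => by simpa using h.infimum_iterate_slide_eq hi hm hy j)
      (fun j _ => by simpa using h.infimum_inv_iterate_slide_eq hi hm hy j)
    simp only [inv_one, one_mul, mul_one] at hsl
    have h1 := h.infimum_iterate_slide_eq hi hm hy k
    rw [hsl, hF, h.infimum_conj_mul_zpow hi] at h1
    have h2 := (h.le_infimum_conj_iff hi y _ (p + 1)).2 key
    omega
  · -- In canonical length at most one, `T 1 ≤ 1`, so that `T 1 = 1` and `y` is a power of `Δ`.
    have hT1 : T 1 ≤ 1 := by
      have h1 : Δ ^ p' ≤ y⁻¹ := (hi _ _).2 le_rfl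
      have h2 := (h.zpow_neg_le_inv_iff y (-p')).1 (by simpa using h1)
      have h3 := h.mul_zpow_le (h2.trans (h.zpow_mono (show -p' ≤ p + 1 by omega))) (-(p + 1))
      simpa [hTdef, ← zpow_add] using h3
    have hTk : ∀ k, (fun a => a ⊓ T a)^[k] 1 = T^[k] 1 ∧ T^[k + 1] 1 ≤ T^[k] 1 := fun k => by
      induction k with
      | zero => exact ⟨rfl, hT1⟩
      | succ k ih =>
        constructor
        · rw [Function.iterate_succ_apply', ih.1, Function.iterate_succ_apply' T]
          have h1 := ih.2
          rw [Function.iterate_succ_apply'] at h1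
          exact inf_eq_right.2 h1
        · have h1 := hTmono ih.2
          rwa [← Function.iterate_succ_apply' T, ← Function.iterate_succ_apply' T] at h1
    have hinj : Function.Injective T := fun a b hab => by simpa [hTdef] using hab
    simp only [(hTk _).1, Function.iterate_succ_apply] at hk
    have h4 : T 1 = 1 := hinj.iterate k hk
    have h5 : Δ ^ (p + 1) ≤ y := by
      have : y = Δ ^ (p + 1) := by
        have h6 : y * 1 * Δ ^ (-(p + 1)) = 1 := h4
        rwa [mul_one, zpow_neg, mul_inv_eq_one] at h6
      exact this.ge
    rw [hi] at h5
    omega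


theorem infimum_le_of_isConj {y z : G} (hy : ∃ m : ℕ, 1 ≤ m ∧ (slide Δ i)^[m] y = y)
    (hyz : IsConj y z) : i z ≤ i y := by
  obtain ⟨m, hm, e⟩ := hy
  obtain ⟨c, rfl⟩ := isConj_iff.1 hyz
  simpa using h.infimum_le_of_periodic hi hm e c⁻¹

omit h hi in
theorem exists_periodic_inv {y : G} (hy : ∃ m : ℕ, 1 ≤ m ∧ (slide Δ i)^[m] y = y) :
    ∃ m : ℕ, 1 ≤ m ∧ (slide Δ i)^[m] y⁻¹ = y⁻¹ := by
  obtain ⟨m, hm, e⟩ := hy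
  exact ⟨m, hm, by rw [iterate_slide_inv, e]⟩

theorem infimum_inv_le_of_isConj {y z : G} (hy : ∃ m : ℕ, 1 ≤ m ∧ (slide Δ i)^[m] y = y)
    (hyz : IsConj y z) : i z⁻¹ ≤ i y⁻¹ := by
  refine h.infimum_le_of_isConj hi (exists_periodic_inv hy) ?_
  obtain ⟨c, rfl⟩ := isConj_iff.1 hyz
  exact isConj_iff.2 ⟨c, by group⟩

omit hi in
theorem iterate_slideOp_mono (y : G) (p p' : ℤ) (k : ℕ) :
    Monotone ((slideOp Δ y p p')^[k]) := fun a b hab => by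
  have := h.iterate_slideOp_inf y p p' k a b
  rw [inf_eq_left.2 hab] at this
  exact inf_eq_left.1 this.symm

omit hi in
theorem iterate_slideOp_mul_eq_pow {y v c : G} {p p' : ℤ} {n : ℕ} (hv : Commute v y)
    (hc : (slideOp Δ y p p')^[n] c = v * c) (k : ℕ) :
    (slideOp Δ y p p')^[n * k] c = v ^ k * c := by
  induction k with
  | zero => simp
  | succ k ih =>
    rw [Nat.mul_succ, Nat.add_comm, Function.iterate_add_apply, ih,
      iterate_slideOp_mul_left (hv.pow_left k) p p' h, hc, pow_succ, mul_assoc]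

omit hi in
theorem iterate_slideOp_mul_eq_mul_pow {y a w : G} {p p' : ℤ} {n : ℕ}
    (hw : Commute w (a⁻¹ * y * a)) (ha : (slideOp Δ y p p')^[n] a = a * w) (k : ℕ) :
    (slideOp Δ y p p')^[n * k] a = a * w ^ k := by
  induction k with
  | zero => simp
  | succ k ih =>
    rw [Nat.mul_succ, Nat.add_comm, Function.iterate_add_apply, ih,
      h.iterate_slideOp_mul_right n (hw.pow_left k), ha, pow_succ]
    group

/-- Transport along a sliding circuit permutes the conjugators between two periodic elements,
and it preserves the finite intervals `[Δ ^ (-n), Δ ^ n]`; hence each conjugator is periodic. -/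
theorem exists_iterate_slideOp_eq_mul {y a : G}
    (hy : ∃ m : ℕ, 1 ≤ m ∧ (slide Δ i)^[m] y = y)
    (ha : ∃ m : ℕ, 1 ≤ m ∧ (slide Δ i)^[m] (a⁻¹ * y * a) = a⁻¹ * y * a) :
    ∃ n : ℕ, 1 ≤ n ∧ ∃ v : G, Commute v y ∧ (slideOp Δ y (i y) (i y⁻¹))^[n] 1 = v ∧
      (slideOp Δ y (i y) (i y⁻¹))^[n] a = v * a := by
  have hconj : IsConj y (a⁻¹ * y * a) := isConj_iff.2 ⟨a⁻¹, by simp⟩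
  have hp := le_antisymm (h.infimum_le_of_isConj hi hy hconj)
    (h.infimum_le_of_isConj hi ha hconj.symm)
  have hp' := le_antisymm (h.infimum_inv_le_of_isConj hi hy hconj)
    (h.infimum_inv_le_of_isConj hi ha hconj.symm)
  obtain ⟨m₁, hm₁, e₁⟩ := hy
  obtain ⟨m₂, hm₂, e₂⟩ := ha
  set p := i y
  set p' := i y⁻¹
  set N := m₁ * m₂
  have hN : 1 ≤ N := Nat.mul_pos hm₁ hm₂
  have f₁ : (slide Δ i)^[N] y = y := Function.IsPeriodicPt.mul_const e₁ m₂
  have f₂ : (slide Δ i)^[N] (a⁻¹ * y * a) = a⁻¹ * y * a :=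
    Function.IsPeriodicPt.const_mul e₂ m₁
  have key : ∀ c : G, (slide Δ i)^[N] (c⁻¹ * y * c) = c⁻¹ * y * c → i (c⁻¹ * y * c) = p →
      i (c⁻¹ * y * c)⁻¹ = p' →
      Commute (c⁻¹ * (slideOp Δ y p p')^[N] c) (c⁻¹ * y * c) := fun c hc hcp hcp' => by
    have e := h.iterate_slide_conj (i := i) (y := y) (β := c) (p := p) (p' := p') N
      (fun j _ => by rw [h.infimum_iterate_slide_eq hi hN hc, hcp])
      (fun j _ => by rw [h.infimum_inv_iterate_slide_eq hi hN hc, hcp'])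
    rw [hc] at e
    set g := (slideOp Δ y p p')^[N] c
    show c⁻¹ * g * (c⁻¹ * y * c) = c⁻¹ * y * c * (c⁻¹ * g)
    calc c⁻¹ * g * (c⁻¹ * y * c) = c⁻¹ * g * (g⁻¹ * y * g) := by rw [e]
      _ = _ := by group
  set v := (slideOp Δ y p p')^[N] 1 with hv
  set w := a⁻¹ * (slideOp Δ y p p')^[N] a with hw
  have hvy : Commute v y := by
    simpa [← hv] using key 1 (by simpa using f₁) (by simp [p]) (by simp [p'])
  have hwy : Commute w (a⁻¹ * y * a) := key a f₂ hp hp'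
  have hvk : ∀ k, (slideOp Δ y p p')^[N * k] 1 = v ^ k := fun k => by
    simpa using h.iterate_slideOp_mul_eq_pow hvy (c := 1) (by rw [mul_one]) k
  have hwk : ∀ k, (slideOp Δ y p p')^[N * k] a = a * w ^ k :=
    h.iterate_slideOp_mul_eq_mul_pow hwy (by rw [hw, mul_inv_cancel_left])
  have hΔk : ∀ (k : ℕ) (m : ℤ), (slideOp Δ y p p')^[N * k] (Δ ^ m) = v ^ k * Δ ^ m :=
    fun k m => by
      have := h.iterate_slideOp_mul_zpow y p p' (N * k) 1 m
      rwa [one_mul, hvk] at this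
  obtain ⟨n₁, hn₁⟩ := h.exists_zpow_neg_le a
  obtain ⟨n₂, hn₂⟩ := h.exists_le_pow a
  obtain ⟨k, l, hkl, e⟩ := Set.Finite.exists_lt_map_eq_of_forall_mem
    (f := fun k : ℕ => (v ^ k)⁻¹ * (a * w ^ k)) (t := Set.Icc (Δ ^ (-(n₁ : ℤ))) (Δ ^ (n₂ : ℤ)))
    (fun k => by
      constructor <;> rw [← h.mul_left_le_iff (v ^ k), mul_inv_cancel_left, ← hΔk, ← hwk]
      · exact h.iterate_slideOp_mono y p p' _ hn₁
      · exact h.iterate_slideOp_mono y p p' _ (by simpa using hn₂)) (h.finite_Icc_any _ _)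
  obtain ⟨d, rfl⟩ := Nat.exists_eq_add_of_lt hkl
  refine ⟨N * (d + 1), Nat.mul_pos hN (Nat.succ_pos d), v ^ (d + 1), hvy.pow_left _, hvk _, ?_⟩
  rw [hwk]
  have e' : (v ^ k)⁻¹ * (a * w ^ k) = (v ^ (k + (d + 1)))⁻¹ * (a * w ^ (k + (d + 1))) := e
  rw [Nat.add_comm k, pow_add, pow_add w] at e'
  simp only [mul_inv_rev, mul_assoc, mul_right_inj] at e'
  rw [← mul_assoc, ← mul_assoc, mul_left_inj, mul_assoc] at e'
  exact (eq_inv_mul_iff_mul_eq.1 e').symm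

/-- The conjugators from a periodic element to periodic elements are closed under meets. -/
theorem exists_periodic_conj_inf {y a b : G}
    (hy : ∃ m : ℕ, 1 ≤ m ∧ (slide Δ i)^[m] y = y)
    (ha : ∃ m : ℕ, 1 ≤ m ∧ (slide Δ i)^[m] (a⁻¹ * y * a) = a⁻¹ * y * a)
    (hb : ∃ m : ℕ, 1 ≤ m ∧ (slide Δ i)^[m] (b⁻¹ * y * b) = b⁻¹ * y * b) :
    ∃ m : ℕ, 1 ≤ m ∧
      (slide Δ i)^[m] ((a ⊓ b)⁻¹ * y * (a ⊓ b)) = (a ⊓ b)⁻¹ * y * (a ⊓ b) := by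
  have hconj : ∀ c : G, IsConj y (c⁻¹ * y * c) := fun c => isConj_iff.2 ⟨c⁻¹, by simp⟩
  have hinv : ∀ c : G, (c⁻¹ * y * c)⁻¹ = c⁻¹ * y⁻¹ * c := fun c => by group
  obtain ⟨n₁, hn₁, v₁, hv₁, e₁, f₁⟩ := h.exists_iterate_slideOp_eq_mul hi hy ha
  obtain ⟨n₂, hn₂, v₂, hv₂, e₂, f₂⟩ := h.exists_iterate_slideOp_eq_mul hi hy hb
  have g₁ := h.iterate_slideOp_mul_eq_pow hv₁ f₁ n₂
  have g₂ := h.iterate_slideOp_mul_eq_pow hv₂ f₂ n₁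
  have k₁ := h.iterate_slideOp_mul_eq_pow hv₁ (c := 1) (by rw [e₁, mul_one]) n₂
  have k₂ := h.iterate_slideOp_mul_eq_pow hv₂ (c := 1) (by rw [e₂, mul_one]) n₁
  rw [Nat.mul_comm n₂] at g₂ k₂
  have hv : v₁ ^ n₂ = v₂ ^ n₁ := by simpa using k₁.symm.trans k₂
  refine ⟨n₁ * n₂, Nat.mul_pos hn₁ hn₂, ?_⟩
  have hge : i y ≤ i ((a ⊓ b)⁻¹ * y * (a ⊓ b)) :=
    h.le_infimum_conj_inf hi (h.infimum_le_of_isConj hi ha (hconj a).symm)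
      (h.infimum_le_of_isConj hi hb (hconj b).symm)
  have hge' : i y⁻¹ ≤ i ((a ⊓ b)⁻¹ * y * (a ⊓ b))⁻¹ := by
    rw [hinv]
    refine h.le_infimum_conj_inf hi ?_ ?_
    · rw [← hinv]; exact h.infimum_inv_le_of_isConj hi ha (hconj a).symm
    · rw [← hinv]; exact h.infimum_inv_le_of_isConj hi hb (hconj b).symm
  have hj : ∀ j, IsConj y ((slide Δ i)^[j] ((a ⊓ b)⁻¹ * y * (a ⊓ b))) := fun j =>
    (hconj _).trans (isConj_iterate_slide j _)
  rw [h.iterate_slide_conj (p := i y) (p' := i y⁻¹) (n₁ * n₂)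
    (fun j _ => le_antisymm (h.infimum_le_of_isConj hi hy (hj j))
      (hge.trans (h.infimum_iterate_slide_mono hi _ (Nat.zero_le j))))
    (fun j _ => le_antisymm (h.infimum_inv_le_of_isConj hi hy (hj j)) (by
      rw [← iterate_slide_inv]
      exact hge'.trans (h.infimum_iterate_slide_mono hi _ (Nat.zero_le j)))),
    h.iterate_slideOp_inf, g₁, g₂, ← hv, ← h.mul_inf]
  have hc := (hv₁.pow_left n₂).inv_left.eq
  set u := v₁ ^ n₂
  calc (u * (a ⊓ b))⁻¹ * y * (u * (a ⊓ b)) = (a ⊓ b)⁻¹ * (u⁻¹ * y) * u * (a ⊓ b) := by group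
    _ = _ := by rw [hc]; group

theorem slide_conj_garside (x : G) :
    slide Δ i (Δ⁻¹ * x * Δ) = Δ⁻¹ * slide Δ i x * Δ := by
  have hc : ∀ k : ℤ, Δ⁻¹ * x * Δ * Δ ^ k = Δ⁻¹ * (x * Δ ^ k) * Δ ^ (1 : ℤ) := fun k => by group
  have hc' : ∀ k : ℤ, (Δ⁻¹ * x * Δ)⁻¹ * Δ ^ k = Δ⁻¹ * (x⁻¹ * Δ ^ k) * Δ ^ (1 : ℤ) := fun k => by
    group
  have hi1 : i (Δ⁻¹ * x * Δ) = i x := by simpa using h.infimum_conj_zpow hi x 1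
  have hi2 : i (Δ⁻¹ * x * Δ)⁻¹ = i x⁻¹ := by
    have := h.infimum_conj_zpow hi x⁻¹ 1
    rw [zpow_one] at this
    rw [← this]; congr 1; group
  have hp : prefPrefix Δ i (Δ⁻¹ * x * Δ) = Δ⁻¹ * prefPrefix Δ i x * Δ ^ (1 : ℤ) := by
    simp only [prefPrefix, hi1, hi2, hc, hc', h.mul_inf, h.inf_mul_zpow]
    simp
  simp only [slide, hp]
  group

theorem exists_periodic_conj_garside {x : G} (hx : ∃ m : ℕ, 1 ≤ m ∧ (slide Δ i)^[m] x = x) :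
    ∃ m : ℕ, 1 ≤ m ∧ (slide Δ i)^[m] (Δ⁻¹ * x * Δ) = Δ⁻¹ * x * Δ := by
  obtain ⟨m, hm, e⟩ := hx
  refine ⟨m, hm, ?_⟩
  have := ((show Function.Commute (slide Δ i) (fun x => Δ⁻¹ * x * Δ) from
    h.slide_conj_garside hi).iterate_left m) x
  rw [this, e]

theorem finite_periodic_isConj (x : G) :
    {y : G | IsConj x y ∧ ∃ m : ℕ, 1 ≤ m ∧ (slide Δ i)^[m] y = y}.Finite := by
  rcases Set.eq_empty_or_nonempty
    {y : G | IsConj x y ∧ ∃ m : ℕ, 1 ≤ m ∧ (slide Δ i)^[m] y = y} with he | ⟨y, hxy, hy⟩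
  · rw [he]; exact Set.finite_empty
  · refine (h.finite_le_infimum hi (i y) (i y⁻¹)).subset ?_
    rintro z ⟨hxz, hz⟩
    have hc := hxz.symm.trans hxy
    exact ⟨h.infimum_le_of_isConj hi hz hc, h.infimum_inv_le_of_isConj hi hz hc⟩

end

end IsGarsideElement

end Sliding

/-! ### Left normal forms -/

namespace IsGarsideElement

variable {G : Type*} [Group G] [SemilatticeInf G] {Δ : G} (h : IsGarsideElement Δ)

include h

theorem one_le_prod {l : List G} (hl : ∀ s ∈ l, 1 ≤ s) : 1 ≤ l.prod := by
  induction l with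
  | nil => simp
  | cons a l ih =>
    rw [List.prod_cons]
    exact h.one_le_mul (hl a (by simp)) (ih fun s hs => hl s (by simp [hs]))

theorem le_mul_self_of_one_le {a : G} (ha : 1 ≤ a) : Δ ≤ a * Δ := by
  simpa using h.mul_le_mul _ _ ha

/-- The first letter of a left weighted word is the maximal simple prefix of the product. -/
theorem prod_inf_eq_head {a : G} {l : List G} (hl : ∀ s ∈ a :: l, 1 ≤ s ∧ s ≤ Δ)
    (hc : List.IsChain (fun a b : G => a⁻¹ * Δ ⊓ b = 1) (a :: l)) : (a :: l).prod ⊓ Δ = a := by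
  induction l generalizing a with
  | nil => simpa using (hl a (by simp)).2
  | cons b l ih =>
    rw [List.isChain_cons_cons] at hc
    have hb := ih (fun s hs => hl s (by simp [List.mem_cons.1 hs])) hc.2
    obtain ⟨ha1, -⟩ := hl a (by simp)
    have hle : a⁻¹ * Δ ≤ Δ := by
      rw [← h.mul_left_le_iff a, mul_inv_cancel_left]
      exact h.le_mul_self_of_one_le ha1
    have hm : (b :: l).prod ⊓ a⁻¹ * Δ = 1 := by
      rw [← inf_eq_right.2 hle, ← inf_assoc, hb, inf_comm, hc.1]
    rw [List.prod_cons]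
    have := h.mul_inf a (b :: l).prod (a⁻¹ * Δ)
    rw [hm, mul_one, mul_inv_cancel_left] at this
    exact this.symm

/-- The exponent of `Δ` in a left normal form is the infimum. For `Δ = 1` the group is trivial and
the exponent is arbitrary. -/
theorem zpow_le_iff_of_normalForm (hΔ : Δ ≠ 1) {p : ℤ} {l : List G}
    (hl : ∀ s ∈ l, (1 ≤ s ∧ s ≤ Δ) ∧ s ≠ 1 ∧ s ≠ Δ)
    (hc : List.IsChain (fun a b : G => a⁻¹ * Δ ⊓ b = 1) l) (k : ℤ) :
    Δ ^ k ≤ Δ ^ p * l.prod ↔ k ≤ p := by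
  constructor
  · intro hk
    by_contra! hlt
    have h1 : Δ ^ p * Δ ≤ Δ ^ p * l.prod := by
      rw [← zpow_add_one]
      exact (h.zpow_mono (by omega)).trans hk
    rw [h.mul_left_le_iff] at h1
    cases l with
    | nil => exact hΔ (le_antisymm (by simpa using h1) h.one_le)
    | cons a l =>
      have h2 := h.prod_inf_eq_head (fun s hs => (hl s hs).1) hc
      rw [inf_eq_right.2 h1] at h2
      exact (hl a (by simp)).2.2 h2.symm
  · intro hk
    exact (h.zpow_mono hk).trans (h.le_mul_iff.2 (h.one_le_prod fun s hs => (hl s hs).1.1))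

theorem exists_normalForm_of_one_le {z : G} (hz : 1 ≤ z) (hΔ : ¬ Δ ≤ z) :
    ∃ l : List G, z = l.prod ∧ (∀ s ∈ l, (1 ≤ s ∧ s ≤ Δ) ∧ s ≠ 1 ∧ s ≠ Δ) ∧
      List.IsChain (fun a b : G => a⁻¹ * Δ ⊓ b = 1) l := by
  obtain ⟨n, hn⟩ := h.exists_le_pow z
  induction n generalizing z with
  | zero => exact ⟨[], by simpa using le_antisymm hn (by simpa using hz), by simp, by simp⟩
  | succ n ih =>
    by_cases hz1 : z = 1
    · exact ⟨[], by simpa using hz1, by simp, by simp⟩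
    set s := z ⊓ Δ with hs
    have hs1 : 1 ≤ s := le_inf hz h.one_le
    have hz' : 1 ≤ s⁻¹ * z := h.one_le_inv_mul.2 inf_le_left
    have hΔ' : ¬ Δ ≤ s⁻¹ * z := fun H => by
      rw [← h.mul_left_le_iff s, mul_inv_cancel_left] at H
      exact hΔ ((h.le_mul_self_of_one_le hs1).trans H)
    obtain ⟨l, hl, hls, hlc⟩ := ih hz' hΔ' (h.inf_inv_mul_le_pow hn)
    refine ⟨s :: l, by rw [List.prod_cons, ← hl, mul_inv_cancel_left], ?_, ?_⟩
    · intro t ht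
      rcases List.mem_cons.1 ht with rfl | ht
      · refine ⟨⟨hs1, inf_le_right⟩, fun e => hz1 (h.eq_one_of_inf_eq_one hz e), fun e => hΔ ?_⟩
        rw [← e]; exact inf_le_left
      · exact hls t ht
    · cases l with
      | nil => simp
      | cons b l =>
        refine List.isChain_cons_cons.2 ⟨?_, hlc⟩
        have hb : b ≤ s⁻¹ * z := by
          rw [hl, List.prod_cons, h.le_mul_iff]
          exact h.one_le_prod fun t ht => (hls t (by simp [ht])).1.1
        have e : s⁻¹ * Δ ⊓ s⁻¹ * z = 1 := by
          rw [← h.mul_inf, inf_comm, ← hs, inv_mul_cancel]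
        refine le_antisymm ((inf_le_inf_left _ hb).trans e.le) (le_inf ?_ (hls b (by simp)).1.1)
        exact h.one_le_inv_mul.2 inf_le_right

theorem exists_normalForm (hΔ : Δ ≠ 1) (x : G) :
    ∃ (p : ℤ) (l : List G), x = Δ ^ p * l.prod ∧
      (∀ s ∈ l, (1 ≤ s ∧ s ≤ Δ) ∧ s ≠ 1 ∧ s ≠ Δ) ∧
      List.IsChain (fun a b : G => a⁻¹ * Δ ⊓ b = 1) l := by
  obtain ⟨m, hm⟩ := h.exists_zpow_neg_le x
  obtain ⟨n, hn⟩ := h.exists_le_pow x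
  have hbdd : ∀ k : ℤ, Δ ^ k ≤ x → k ≤ n := fun k hk => by
    by_contra! hlt
    have h1 : Δ ^ (n : ℤ) * Δ ≤ Δ ^ (n : ℤ) * 1 := by
      rw [← zpow_add_one, mul_one]
      exact ((h.zpow_mono (by omega)).trans hk).trans (by simpa using hn)
    exact hΔ (le_antisymm ((h.mul_left_le_iff _).1 h1) h.one_le)
  obtain ⟨p, hp, hmax⟩ := Int.exists_greatest_of_bdd ⟨n, hbdd⟩ ⟨_, hm⟩
  obtain ⟨l, hl, hls⟩ := h.exists_normalForm_of_one_le (z := (Δ ^ p)⁻¹ * x)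
    (h.one_le_inv_mul.2 hp) fun H => by
      rw [← h.mul_left_le_iff (Δ ^ p), mul_inv_cancel_left, ← zpow_add_one] at H
      have := hmax _ H
      omega
  exact ⟨p, l, by rw [← hl, mul_inv_cancel_left], hls⟩

end IsGarsideElement

/-! ### The order of a Garside structure -/

namespace GarsideStructure

variable {G : Type*} [Group G] (D : GarsideStructure G)

/-- The order `≼` of a Garside structure, with its greatest common divisors as meets. -/
@[reducible] noncomputable def semilatticeInf : SemilatticeInf G where
  le := D.Le
  le_refl a := by simp [Le, D.P.one_mem]
  le_trans a b c hab hbc := by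
    have := D.P.mul_mem hab hbc
    rwa [mul_assoc, mul_inv_cancel_left] at this
  le_antisymm a b hab hba := by
    have := D.eq_one_of_mem_of_inv_mem _ hab (by simpa [Le] using hba)
    exact inv_mul_eq_one.1 this
  inf := D.meet
  inf_le_left a b := (D.exists_gcd a b).choose_spec.1
  inf_le_right a b := (D.exists_gcd a b).choose_spec.2.1
  le_inf a b c hab hac := (D.exists_gcd b c).choose_spec.2.2 a hab hac

theorem conj_mem {a : G} (ha : a ∈ D.P) : D.Δ⁻¹ * a * D.Δ ∈ D.P := by
  have := Set.mem_image_of_mem (fun a : G => D.Δ⁻¹ * a * D.Δ) (SetLike.mem_coe.2 ha)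
  rwa [D.conj_Δ] at this

theorem conj_inv_mem {a : G} (ha : a ∈ D.P) : D.Δ * a * D.Δ⁻¹ ∈ D.P := by
  have ha' : a ∈ (D.P : Set G) := ha
  rw [← D.conj_Δ] at ha'
  obtain ⟨b, hb, rfl⟩ := ha'
  simpa [mul_assoc] using hb

theorem isGarsideElement (hD : D.FiniteType) : @IsGarsideElement G _ D.semilatticeInf D.Δ := by
  let := D.semilatticeInf
  have le_def : ∀ a b : G, a ≤ b ↔ a⁻¹ * b ∈ D.P := fun _ _ => Iff.rfl
  have hmul : ∀ a b c : G, b ≤ c → a * b ≤ a * c := fun a b c hbc => by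
    rw [le_def] at hbc ⊢
    simpa [mul_assoc] using hbc
  have hr : ∀ a b : G, a ≤ b → a * D.Δ ≤ b * D.Δ := fun a b hab => by
    have := D.conj_mem hab
    rw [le_def]
    simpa [mul_assoc] using this
  have hr' : ∀ a b : G, a ≤ b → a * D.Δ⁻¹ ≤ b * D.Δ⁻¹ := fun a b hab => by
    have := D.conj_inv_mem hab
    rw [le_def]
    simpa [mul_assoc] using this
  have hrn : ∀ (n : ℕ) (a b : G), a ≤ b → a * D.Δ ^ n ≤ b * D.Δ ^ n := fun n => by
    induction n with
    | zero => simp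
    | succ n ih => intro a b hab; simpa [pow_succ, mul_assoc] using hr _ _ (ih a b hab)
  have h1 : (1 : G) ≤ D.Δ := (le_def _ _).2 (by simpa using D.Δ_mem)
  have hbdd : ∀ x : G, (∃ n : ℕ, x ≤ D.Δ ^ n) ∧ ∃ n : ℕ, x⁻¹ ≤ D.Δ ^ n := fun x => by
    have hx : x ∈ Subgroup.closure {s : G | (1 : G)⁻¹ * s ∈ D.P ∧ s⁻¹ * D.Δ ∈ D.P} := by
      rw [D.closure_simples]; exact Subgroup.mem_top x
    induction hx using Subgroup.closure_induction with
    | mem s hs =>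
      refine ⟨⟨1, by rw [pow_one]; exact hs.2⟩, 0, (le_def _ _).2 (by simpa using hs.1)⟩
    | one => exact ⟨⟨0, by simp⟩, 0, by simp⟩
    | mul a b _ _ iha ihb =>
      have key : ∀ a b : G, (∃ n : ℕ, a ≤ D.Δ ^ n) → (∃ n : ℕ, b ≤ D.Δ ^ n) →
          ∃ n : ℕ, a * b ≤ D.Δ ^ n := by
        rintro a b ⟨m, hm⟩ ⟨n, hn⟩
        refine ⟨m + n, ?_⟩
        rw [pow_add]
        exact (hmul _ _ _ hn).trans (hrn _ _ _ hm)
      rw [mul_inv_rev]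
      exact ⟨key _ _ iha.1 ihb.1, key _ _ ihb.2 iha.2⟩
    | inv a _ ih => exact ⟨ih.2, by simpa using ih.1⟩
  exact
    { mul_left_le := hmul
      one_le := h1
      mul_le_mul := hr
      mul_inv_le_mul_inv := hr'
      exists_le_pow := fun x => (hbdd x).1
      finite_Icc := hD }

theorem Δ_ne_one [Nontrivial G] : D.Δ ≠ 1 := fun e => by
  have h : {s : G | (1 : G)⁻¹ * s ∈ D.P ∧ s⁻¹ * D.Δ ∈ D.P} ⊆ {1} := fun s hs => by
    obtain ⟨h1, h2⟩ := hs
    exact D.eq_one_of_mem_of_inv_mem s (by simpa using h1) (by simpa [e] using h2)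
  have h2 := D.closure_simples
  rw [(Subgroup.closure_eq_bot_iff).2 h] at h2
  exact bot_ne_top h2

theorem isInfimum [Nontrivial G] (hD : D.FiniteType) :
    @IsInfimum G _ D.semilatticeInf D.Δ D.infimum := by
  let := D.semilatticeInf
  have h := D.isGarsideElement hD
  intro x k
  have hex : ∃ p : ℤ, ∃ l : List G, D.IsLeftNormalForm p l x := h.exists_normalForm D.Δ_ne_one x
  obtain ⟨l, hx, hl, hc⟩ : ∃ l : List G, D.IsLeftNormalForm (D.infimum x) l x :=
    Classical.epsilon_spec hex
  have := h.zpow_le_iff_of_normalForm D.Δ_ne_one (p := D.infimum x) hl hc k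
  rwa [← hx] at this

/-! ### The set of sliding circuits -/

variable {D} {x y : G}

/-- In the trivial group the infimum is an arbitrary integer, so that case is treated apart. -/
theorem SC_nonempty (hD : D.FiniteType) (x : G) : (D.SC x).Nonempty := by
  rcases subsingleton_or_nontrivial G with hG | hG
  · exact ⟨x, IsConj.refl x, 1, le_rfl, Subsingleton.elim _ _⟩
  · let := D.semilatticeInf
    obtain ⟨k, m, hm, e⟩ :=
      (D.isGarsideElement hD).exists_iterate_slide_periodic (D.isInfimum hD) x
    exact ⟨_, isConj_iterate_slide k x, m, hm, e⟩

theorem finite_SC (hD : D.FiniteType) (x : G) : (D.SC x).Finite := by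
  rcases subsingleton_or_nontrivial G with hG | hG
  · exact Set.subsingleton_of_subsingleton.finite
  · let := D.semilatticeInf
    exact (D.isGarsideElement hD).finite_periodic_isConj (D.isInfimum hD) x

theorem conj_meet_mem_SC (hD : D.FiniteType) {a b : G} (hy : y ∈ D.SC x)
    (ha : a⁻¹ * y * a ∈ D.SC x) (hb : b⁻¹ * y * b ∈ D.SC x) :
    (D.meet a b)⁻¹ * y * D.meet a b ∈ D.SC x := by
  rcases subsingleton_or_nontrivial G with hG | hG
  · rwa [Subsingleton.elim (D.meet a b) a]
  · let := D.semilatticeInf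
    exact ⟨hy.1.trans (isConj_iff.2 ⟨(D.meet a b)⁻¹, by simp⟩),
      (D.isGarsideElement hD).exists_periodic_conj_inf (D.isInfimum hD) hy.2 ha.2 hb.2⟩

theorem conj_Δ_mem_SC (hD : D.FiniteType) (hy : y ∈ D.SC x) : D.Δ⁻¹ * y * D.Δ ∈ D.SC x := by
  rcases subsingleton_or_nontrivial G with hG | hG
  · rwa [Subsingleton.elim (D.Δ⁻¹ * y * D.Δ) y]
  · let := D.semilatticeInf
    exact ⟨hy.1.trans (isConj_iff.2 ⟨D.Δ⁻¹, by simp⟩),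
      (D.isGarsideElement hD).exists_periodic_conj_garside (D.isInfimum hD) hy.2⟩

/-- Some positive power of `Δ` commutes with a given element of `SC(x)`, because conjugation by
`Δ` permutes this finite set. -/
theorem exists_pow_Δ_commute (hD : D.FiniteType) (hy : y ∈ D.SC x) :
    ∃ e : ℕ, 1 ≤ e ∧ Commute (D.Δ ^ e) y := by
  have hmem : ∀ n : ℕ, (D.Δ ^ n)⁻¹ * y * D.Δ ^ n ∈ D.SC x := fun n => by
    induction n with
    | zero => simpa using hy
    | succ n ih => simpa [pow_succ, mul_assoc] using conj_Δ_mem_SC hD ih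
  obtain ⟨k, l, hkl, e⟩ := Set.Finite.exists_lt_map_eq_of_forall_mem hmem (finite_SC hD x)
  obtain ⟨d, rfl⟩ := Nat.exists_eq_add_of_lt hkl
  refine ⟨d + 1, by omega, ?_⟩
  have e' : (D.Δ ^ k)⁻¹ * y * D.Δ ^ k =
    (D.Δ ^ (d + 1 + k))⁻¹ * y * D.Δ ^ (d + 1 + k) := by rw [e]; congr 2 <;> ring_nf
  rw [pow_add, mul_inv_rev, mul_assoc, mul_assoc, mul_assoc, mul_right_inj,
    eq_inv_mul_iff_mul_eq, ← mul_assoc, ← mul_assoc, mul_left_inj] at e'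
  exact e'

/-! ### The sliding circuits graph -/

/-- A nontrivial prefix of an indecomposable conjugator that also leads to a sliding circuit is
the whole conjugator. -/
theorem IsIndecomposableConjugator.eq_of_prefix {s t : G}
    (hs : D.IsIndecomposableConjugator x y s) (ht : t ∈ D.P) (ht1 : t ≠ 1)
    (hts : t⁻¹ * s ∈ D.P) (hty : t⁻¹ * y * t ∈ D.SC x) : t = s := by
  by_contra hne
  exact hs.2.2.2 ⟨t, t⁻¹ * s, ht, hts, ht1, fun e => hne (inv_mul_eq_one.1 e),
    (mul_inv_cancel_left _ _).symm, hty⟩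

theorem IsIndecomposableConjugator.mem_simples (hD : D.FiniteType) {s : G} (hy : y ∈ D.SC x)
    (hs : D.IsIndecomposableConjugator x y s) : s ∈ D.simples := by
  let := D.semilatticeInf
  have h := D.isGarsideElement hD
  have h1 : (1 : G) ≤ s := show (1 : G)⁻¹ * s ∈ D.P by simpa using hs.1
  have ht : (1 : G) ≤ s ⊓ D.Δ := le_inf h1 h.one_le
  have e : s ⊓ D.Δ = s := hs.eq_of_prefix
    (by simpa using (show (1 : G)⁻¹ * (s ⊓ D.Δ) ∈ D.P from ht))
    (fun e => hs.2.1 (h.eq_one_of_inf_eq_one h1 e))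
    (show s ⊓ D.Δ ≤ s from inf_le_left)
    (conj_meet_mem_SC hD hy hs.2.2.1 (conj_Δ_mem_SC hD hy))
  exact ⟨h1, show s ≤ D.Δ from inf_eq_left.1 e⟩

theorem exists_atom_prefix (hD : D.FiniteType) {s : G} (hs : s ∈ D.P) (hs1 : s ≠ 1) :
    ∃ a ∈ D.atoms, a⁻¹ * s ∈ D.P := by
  let := D.semilatticeInf
  have h := D.isGarsideElement hD
  have pos : ∀ a : G, a ∈ D.P ↔ (1 : G) ≤ a := fun a => by
    show a ∈ D.P ↔ (1 : G)⁻¹ * a ∈ D.P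
    simp
  have hfin : {a : G | a ∈ Set.Icc 1 s ∧ a ≠ 1}.Finite :=
    (h.finite_Icc_any 1 s).subset fun a ha => ha.1
  obtain ⟨a, ⟨⟨ha, has⟩, ha1⟩, hmin⟩ :=
    hfin.exists_minimal ⟨s, ⟨(pos s).1 hs, le_rfl⟩, hs1⟩
  refine ⟨a, ⟨(pos a).2 ha, ha1, fun b c hb hc e => ?_⟩, has⟩
  by_contra! hne
  have hba : b ≤ a := by rw [e, h.le_mul_iff]; exact (pos c).1 hc
  have hab := hmin ⟨⟨(pos b).1 hb, hba.trans has⟩, hne.1⟩ hba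
  have hb' := le_antisymm hba hab
  exact hne.2 (by simpa [← hb'] using e)

/-- Two indecomposable conjugators with a common atom as prefix coincide with their greatest
common divisor. -/
theorem IsIndecomposableConjugator.eq_of_atom_prefix (hD : D.FiniteType) {s t a : G}
    (hy : y ∈ D.SC x) (hs : D.IsIndecomposableConjugator x y s)
    (ht : D.IsIndecomposableConjugator x y t) (ha : a ∈ D.atoms) (has : a⁻¹ * s ∈ D.P)
    (hat : a⁻¹ * t ∈ D.P) : s = t := by
  let := D.semilatticeInf
  have ha1 : (1 : G) ≤ a := show (1 : G)⁻¹ * a ∈ D.P by simpa using ha.1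
  have hle : a ≤ s ⊓ t := le_inf has hat
  have hP : s ⊓ t ∈ D.P := by
    simpa using (show (1 : G)⁻¹ * (s ⊓ t) ∈ D.P from ha1.trans hle)
  have hne : s ⊓ t ≠ 1 := fun e => ha.2.1 (le_antisymm (e ▸ hle) ha1)
  have hSC := conj_meet_mem_SC hD hy hs.2.2.1 ht.2.2.1
  exact (hs.eq_of_prefix hP hne (show s ⊓ t ≤ s from inf_le_left) hSC).symm.trans
    (ht.eq_of_prefix hP hne (show s ⊓ t ≤ t from inf_le_right) hSC)

/-- A positive conjugator between two elements of `SC(x)` factors into indecomposable ones, by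
induction on the size of the interval below it. -/
theorem nonempty_path_of_mem (hD : D.FiniteType) (y z : D.SCG x) (α : G) (hα : α ∈ D.P)
    (e : α⁻¹ * y.1 * α = z.1) : Nonempty (Quiver.Path y z) := by
  let := D.semilatticeInf
  have h := D.isGarsideElement hD
  have pos : ∀ a : G, a ∈ D.P ↔ (1 : G) ≤ a := fun a => by
    show a ∈ D.P ↔ (1 : G)⁻¹ * a ∈ D.P
    simp
  induction hn : (Set.Icc 1 α).ncard using Nat.strong_induction_on generalizing y z α with
  | _ n ih =>
    subst hn
    by_cases hα1 : α = 1
    · have : y = z := Subtype.ext (by simpa [hα1] using e)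
      exact this ▸ ⟨Quiver.Path.nil⟩
    by_cases hind : D.IsIndecomposableConjugator x y.1 α
    · exact ⟨Quiver.Hom.toPath (⟨α, hind, e⟩ : y ⟶ z)⟩
    · have hz : α⁻¹ * y.1 * α ∈ D.SC x := e ▸ z.2
      have hex : ∃ s₁ s₂ : G, s₁ ∈ D.P ∧ s₂ ∈ D.P ∧ s₁ ≠ 1 ∧ s₂ ≠ 1 ∧ α = s₁ * s₂ ∧
          s₁⁻¹ * y.1 * s₁ ∈ D.SC x := by
        by_contra H
        exact hind ⟨hα, hα1, hz, H⟩
      obtain ⟨s₁, s₂, h₁, h₂, h₁', h₂', rfl, hw⟩ := hex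
      have hle : s₁ ≤ s₁ * s₂ := h.le_mul_iff.2 ((pos _).1 h₂)
      have c₁ : (Set.Icc 1 s₁).ncard < (Set.Icc 1 (s₁ * s₂)).ncard := by
        refine Set.ncard_lt_ncard ⟨Set.Icc_subset_Icc_right hle, fun H => h₂' ?_⟩
          (h.finite_Icc_any _ _)
        have := (H ⟨(pos _).1 hα, le_rfl⟩).2
        simpa using le_antisymm this hle
      have c₂ : (Set.Icc 1 s₂).ncard < (Set.Icc 1 (s₁ * s₂)).ncard := by
        rw [← Set.ncard_image_of_injective _ (mul_right_injective s₁)]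
        refine Set.ncard_lt_ncard ⟨?_, fun H => h₁' ?_⟩ (h.finite_Icc_any _ _)
        · rintro _ ⟨b, ⟨hb, hb'⟩, rfl⟩
          exact ⟨h.one_le_mul ((pos _).1 h₁) hb, h.mul_left_le _ _ _ hb'⟩
        · obtain ⟨b, ⟨hb, -⟩, hb1⟩ := H ⟨le_rfl, (pos _).1 hα⟩
          have : s₁ ≤ 1 := by rw [← hb1]; exact h.le_mul_iff.2 hb
          exact le_antisymm this ((pos _).1 h₁)
      obtain ⟨p₁⟩ := ih _ c₁ y ⟨_, hw⟩ s₁ h₁ rfl rfl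
      obtain ⟨p₂⟩ := ih _ c₂ ⟨_, hw⟩ z s₂ h₂ (by rw [← e]; group) rfl
      exact ⟨p₁.comp p₂⟩

theorem isStronglyConnected_SCG (hD : D.FiniteType) (x : G) :
    Quiver.IsStronglyConnected (D.SCG x) := by
  intro y z
  let := D.semilatticeInf
  have h := D.isGarsideElement hD
  obtain ⟨c, hc⟩ := isConj_iff.1 (y.2.1.symm.trans z.2.1)
  obtain ⟨e, he, hcomm⟩ := exists_pow_Δ_commute hD z.2
  obtain ⟨n, hn⟩ := h.exists_le_pow c
  -- Multiplying by a power of `Δ` that commutes with `z` makes the conjugator positive.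
  refine nonempty_path_of_mem hD y z (c⁻¹ * (D.Δ ^ e) ^ n) ?_ ?_
  · have hle : c ≤ (D.Δ ^ e) ^ n := by
      rw [← pow_mul]
      refine hn.trans ?_
      have := h.zpow_mono (Int.ofNat_le.2 (Nat.le_mul_of_pos_left n he))
      simpa only [zpow_natCast, Int.ofNat_eq_natCast] using this
    exact hle
  · have h1 := (hcomm.pow_left n).inv_left.eq
    calc _ = ((D.Δ ^ e) ^ n)⁻¹ * (c * y.1 * c⁻¹) * (D.Δ ^ e) ^ n := by group
      _ = z.1 := by rw [hc, h1, inv_mul_cancel_right]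

end GarsideStructure

theorem corollaryC {G : Type*} [Group G] (D : GarsideStructure G) (hD : D.FiniteType) (x : G) :
    -- the graph is finite: finitely many vertices and finitely many arrows
    (Finite (D.SCG x) ∧ Finite (Σ y z : D.SCG x, (y ⟶ z))) ∧
    -- the graph is connected: non-empty, with a directed path between any two vertices
    (Nonempty (D.SCG x) ∧ Quiver.IsStronglyConnected (D.SCG x)) ∧
    -- every arrow is a simple element
    (∀ (y z : D.SCG x) (s : y ⟶ z), s.1 ∈ D.simples) ∧
    -- the number of arrows starting at a vertex is at most the number of atoms
    (∀ y : D.SCG x, ENat.card (Quiver.Star y) ≤ D.atoms.encard) := by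
  have hsimple : ∀ (y z : D.SCG x) (s : y ⟶ z), s.1 ∈ D.simples := fun y z s =>
    s.2.1.mem_simples hD y.2
  have hV : Finite (D.SCG x) := (D.finite_SC hD x).to_subtype
  have hS : Finite D.simples := hD.to_subtype
  refine ⟨⟨hV, ?_⟩, ⟨?_, D.isStronglyConnected_SCG hD x⟩, hsimple, fun y => ?_⟩
  · have (y z : D.SCG x) : Finite (y ⟶ z) :=
      Finite.of_injective (fun s : y ⟶ z => (⟨s.1, hsimple y z s⟩ : D.simples))
        fun s t hst => Subtype.ext (Subtype.mk.inj hst)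
    infer_instance
  · obtain ⟨y, hy⟩ := D.SC_nonempty hD x
    exact ⟨⟨y, hy⟩⟩
  · choose a ha has using fun s : Quiver.Star y =>
      D.exists_atom_prefix hD s.2.2.1.1 s.2.2.1.2.1
    refine ENat.card_le_card_of_injective (f := fun s => (⟨a s, ha s⟩ : D.atoms)) ?_
    rintro ⟨z, s⟩ ⟨z', t⟩ hst
    have hst' : a ⟨z, s⟩ = a ⟨z', t⟩ := congrArg Subtype.val hst
    have e : s.1 = t.1 := s.2.1.eq_of_atom_prefix hD y.2 t.2.1 (ha _) (has ⟨z, s⟩)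
      (hst' ▸ has ⟨z', t⟩)
    have hz : z = z' := Subtype.ext (by rw [← s.2.2, ← t.2.2, e])
    subst hz
    exact congrArg (Sigma.mk z) (Subtype.ext e)
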